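/- Let $p\in(0,1)$ and let $\varepsilon_p$ be a random variable taking the value $1$ with probability $p$ and the value $0$ with probability $1-p$. Let $X,Y$ be independent identically distributed random variables that are almost surely positive, with the pair $(X,Y)$ independent of $\varepsilon_p$ (so that $X,Y,\varepsilon_p$ are mutually independent), and let $a,b>0$ be constants. Consider the linear forms with random coefficients $$L_1=(1-p)aX+\varepsilon_p aY,\qquad L_2=pbX+(1-\varepsilon_p)bY.$$ Then $L_1$ and $L_2$ are independent if and only if $X$ and $Y$ are exponentially distributed, that is, there is $r>0$ such that $X$ and $Y$ both have the density $r e^{-rx}$ on $x>0$ (and $0$ elsewhere). -/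

import Mathlib

open MeasureTheory ProbabilityTheory

/-!
Rescaling the forms, one may take `a = b = 1`. Write `U = (1 - p) X + ε Y`, `V = p X + (1 - ε) Y`
and `M z = E[exp (z X)]`. Conditioning on `ε` gives
`E[exp (u U + v V)] = M ((1 - p) u + p v) (p M u + (1 - p) M v)`.

If `X` is exponential of rate `r`, then `M z = r / (r - z)` and the right-hand side collapses to
`M u * M v`: the pair `(U, V)` is again a pair of independent exponential variables of rate `r`.

Conversely, if `U` and `V` are independent, then the right-hand side is a product `f u * g v` for
real `u, v < 0`. A product `F` satisfies `F ∂₁∂₂F = ∂₁F ∂₂F`; on the diagonal `u = v` this reads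
`M M'' = 2 M' ^ 2`, that is, `(1 / M)'' = 0`. So `1 / M` is affine on the negative half-line, `M`
agrees there with the transform of an exponential law, and the Laplace transform determines the
distribution of a nonnegative random variable.
-/

open Filter Topology

section LaplaceTransform

variable {Ω : Type*} [MeasurableSpace Ω] {μ : Measure Ω} {X : Ω → ℝ}

lemma Iic_subset_integrableExpSet_of_nonneg [IsFiniteMeasure μ] (hX : AEMeasurable X μ)
    (h0 : ∀ᵐ ω ∂μ, 0 ≤ X ω) : Set.Iic 0 ⊆ integrableExpSet X μ := by
  intro t ht
  refine Integrable.of_bound (by fun_prop) 1 ?_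
  filter_upwards [h0] with ω hω
  simpa using mul_nonpos_of_nonpos_of_nonneg ht hω

lemma Iio_subset_interior_integrableExpSet_of_nonneg [IsFiniteMeasure μ] (hX : AEMeasurable X μ)
    (h0 : ∀ᵐ ω ∂μ, 0 ≤ X ω) : Set.Iio 0 ⊆ interior (integrableExpSet X μ) := by
  rw [← interior_Iic]
  exact interior_mono (Iic_subset_integrableExpSet_of_nonneg hX h0)

lemma continuousOn_complexMGF_of_nonneg [IsFiniteMeasure μ] (hX : AEMeasurable X μ)
    (h0 : ∀ᵐ ω ∂μ, 0 ≤ X ω) : ContinuousOn (complexMGF X μ) {z | z.re ≤ 0} := by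
  refine continuousOn_of_dominated (bound := fun _ => 1) (fun z _ => by fun_prop) ?_
    (integrable_const _) (.of_forall fun ω => by fun_prop)
  intro z hz
  filter_upwards [h0] with ω hω
  simpa [Complex.norm_exp] using mul_nonpos_of_nonpos_of_nonneg hz hω

lemma continuousOn_mgf_of_nonneg [IsFiniteMeasure μ] (hX : AEMeasurable X μ)
    (h0 : ∀ᵐ ω ∂μ, 0 ≤ X ω) : ContinuousOn (mgf X μ) (Set.Iic 0) := by
  rw [← re_complexMGF_ofReal']
  exact Complex.continuous_re.comp_continuousOn ((continuousOn_complexMGF_of_nonneg hX h0).comp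
    Complex.continuous_ofReal.continuousOn fun t (ht : t ≤ 0) => by simpa using ht)

lemma mgf_lt_one_of_nonneg [IsProbabilityMeasure μ] (hX : AEMeasurable X μ)
    (h0 : ∀ᵐ ω ∂μ, 0 ≤ X ω) (hne : ¬ X =ᵐ[μ] 0) {t : ℝ} (ht : t < 0) : mgf X μ t < 1 := by
  have hint : Integrable (fun ω => Real.exp (t * X ω)) μ :=
    integrable_of_mem_integrableExpSet (Iic_subset_integrableExpSet_of_nonneg hX h0 ht.le)
  have hle : (fun ω => Real.exp (t * X ω)) ≤ᵐ[μ] fun _ => 1 := by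
    filter_upwards [h0] with ω hω
    exact Real.exp_le_one_iff.2 (mul_nonpos_of_nonpos_of_nonneg ht.le hω)
  have hmgf_le : mgf X μ t ≤ 1 := by
    simpa [mgf] using integral_mono_ae hint (integrable_const _) hle
  refine hmgf_le.lt_of_ne fun heq => hne ?_
  have hexp := (integral_eq_iff_of_ae_le hint (integrable_const _) hle).1 (by simpa [mgf] using heq)
  filter_upwards [hexp] with ω hω
  simpa [ht.ne] using hω

lemma eqOn_complexMGF_of_mgf_eqOn_Iio {Ω' : Type*} [MeasurableSpace Ω'] {ν : Measure Ω'}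
    {Y : Ω' → ℝ} (hX : Set.Iio 0 ⊆ interior (integrableExpSet X μ))
    (hY : Set.Iio 0 ⊆ interior (integrableExpSet Y ν))
    (h : Set.EqOn (mgf X μ) (mgf Y ν) (Set.Iio 0)) :
    Set.EqOn (complexMGF X μ) (complexMGF Y ν) {z | z.re < 0} := by
  refine AnalyticOnNhd.eqOn_of_preconnected_of_frequently_eq (z₀ := ((-1 : ℝ) : ℂ))
    (analyticOnNhd_complexMGF.mono fun z hz => hX hz)
    (analyticOnNhd_complexMGF.mono fun z hz => hY hz)
    ((convex_Iio (0 : ℝ)).linear_preimage Complex.reLm).isPreconnected (by simp) ?_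
  have hreal : ∃ᶠ x : ℝ in 𝓝[≠] (-1), complexMGF X μ x = complexMGF Y ν x := by
    refine Eventually.frequently ?_
    filter_upwards [nhdsWithin_le_nhds (Iio_mem_nhds neg_one_lt_zero)] with x hx
    rw [complexMGF_ofReal, complexMGF_ofReal, h hx]
  exact (Complex.continuous_ofReal.continuousAt.continuousWithinAt.tendsto_nhdsWithin
    fun x (hx : x ≠ -1) => Complex.ofReal_injective.ne hx).frequently hreal

theorem eq_of_mgf_id_eqOn_Iio {μ ν : Measure ℝ} [IsFiniteMeasure μ] [IsFiniteMeasure ν]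
    (hμ : ∀ᵐ x ∂μ, 0 ≤ x) (hν : ∀ᵐ x ∂ν, 0 ≤ x)
    (h : Set.EqOn (mgf id μ) (mgf id ν) (Set.Iio 0)) : μ = ν := by
  have hopen : Set.EqOn (complexMGF id μ) (complexMGF id ν) {z | z.re < 0} :=
    eqOn_complexMGF_of_mgf_eqOn_Iio
      (Iio_subset_interior_integrableExpSet_of_nonneg aemeasurable_id hμ)
      (Iio_subset_interior_integrableExpSet_of_nonneg aemeasurable_id hν) h
  have hclosed : Set.EqOn (complexMGF id μ) (complexMGF id ν) {z | z.re ≤ 0} :=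
    hopen.of_subset_closure (continuousOn_complexMGF_of_nonneg aemeasurable_id hμ)
      (continuousOn_complexMGF_of_nonneg aemeasurable_id hν) (fun z (hz : z.re < 0) => hz.le)
      (Complex.closure_setOfPred_re_lt 0).ge
  refine Measure.ext_of_charFun (funext fun t => ?_)
  rw [← complexMGF_id_mul_I, ← complexMGF_id_mul_I]
  exact hclosed (by simp)

end LaplaceTransform

section ExponentialDistribution

lemma ae_nonneg_gammaMeasure (a r : ℝ) : ∀ᵐ x ∂gammaMeasure a r, 0 ≤ x := by
  simp only [ae_iff, not_le]
  exact (withDensity_apply _ measurableSet_Iio).trans (lintegral_gammaPDF_of_nonpos le_rfl)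

lemma integral_expMeasure {E : Type*} [NormedAddCommGroup E] [NormedSpace ℝ E] {r : ℝ}
    (hr : 0 < r) (f : ℝ → E) :
    ∫ x, f x ∂expMeasure r = ∫ x in Set.Ioi 0, (r * Real.exp (-(r * x))) • f x := by
  have hdensity : (fun x => (exponentialPDF r x).toReal • f x) =
      (Set.Ici 0).indicator fun x => (r * Real.exp (-(r * x))) • f x := by
    ext x
    rcases lt_or_ge x 0 with hx | hx
    · simp [exponentialPDF_of_neg hx, hx]
    · rw [Set.indicator_of_mem (Set.mem_Ici.2 hx), exponentialPDF_of_nonneg hx,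
        ENNReal.toReal_ofReal (by positivity)]
  have hmeas : Measurable (exponentialPDF r) := (measurable_exponentialPDFReal r).ennreal_ofReal
  change ∫ x, f x ∂volume.withDensity (exponentialPDF r) = _
  rw [integral_withDensity_eq_integral_toReal_smul hmeas
      (.of_forall fun x => ENNReal.ofReal_lt_top), hdensity,
    integral_indicator measurableSet_Ici, integral_Ici_eq_integral_Ioi]

lemma complexMGF_id_expMeasure {r : ℝ} (hr : 0 < r) {z : ℂ} (hz : z.re < r) :
    complexMGF id (expMeasure r) z = r / (r - z) := by
  have hre : (z - r).re < 0 := by simpa using hz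
  have hintegrand (x : ℝ) : (r * Real.exp (-(r * x))) • Complex.exp (z * (id x : ℝ)) =
      r * Complex.exp ((z - r) * x) := by
    rw [Complex.real_smul, sub_mul, sub_eq_neg_add, Complex.exp_add]
    push_cast
    exact mul_assoc _ _ _
  rw [complexMGF, integral_expMeasure hr]
  simp only [hintegrand]
  rw [integral_const_mul, integral_exp_mul_complex_Ioi hre, Complex.ofReal_zero, mul_zero,
    Complex.exp_zero, ← neg_sub z, div_neg, neg_div, mul_neg, mul_one_div]

lemma mgf_id_expMeasure {r : ℝ} (hr : 0 < r) {t : ℝ} (ht : t < r) :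
    mgf id (expMeasure r) t = r / (r - t) := by
  have hcomplex := complexMGF_id_expMeasure hr (z := t) ht
  rw [complexMGF_ofReal] at hcomplex
  exact_mod_cast hcomplex

lemma charFun_expMeasure {r : ℝ} (hr : 0 < r) (t : ℝ) :
    charFun (expMeasure r) t = r / (r - t * Complex.I) := by
  rw [← complexMGF_id_mul_I]
  exact complexMGF_id_expMeasure hr (by simpa using hr)

lemma exists_map_eq_expMeasure_of_inv_mgf_affine {Ω : Type*} [MeasurableSpace Ω]
    {P : Measure Ω} [IsProbabilityMeasure P] {X : Ω → ℝ} (hX : AEMeasurable X P)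
    (h0 : ∀ᵐ ω ∂P, 0 ≤ X ω) (hne : ¬ X =ᵐ[P] 0) {α β : ℝ}
    (h : ∀ t < 0, (mgf X P t)⁻¹ = α + β * t) : ∃ r, 0 < r ∧ P.map X = expMeasure r := by
  have hpos {t : ℝ} (ht : t ≤ 0) : 0 < mgf X P t :=
    mgf_pos (Iic_subset_integrableExpSet_of_nonneg hX h0 ht)
  have hclosed : Set.EqOn (fun t => (mgf X P t)⁻¹) (fun t => α + β * t) (Set.Iic 0) :=
    Set.EqOn.of_subset_closure (s := Set.Iio 0) h
      ((continuousOn_mgf_of_nonneg hX h0).inv₀ fun t ht => (hpos ht).ne') (by fun_prop)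
      Set.Iio_subset_Iic_self (closure_Iio 0).ge
  have hα : α = 1 := by simpa using (hclosed Set.self_mem_Iic).symm
  have hβ : β < 0 := by
    have hlt : 1 < (mgf X P (-1))⁻¹ := (one_lt_inv₀ (hpos neg_one_lt_zero.le)).2
      (mgf_lt_one_of_nonneg hX h0 hne neg_one_lt_zero)
    rw [h _ neg_one_lt_zero, hα] at hlt
    linarith
  have hr : 0 < -β⁻¹ := neg_pos.2 (inv_lt_zero.2 hβ)
  have := isProbabilityMeasure_expMeasure hr
  have := Measure.isProbabilityMeasure_map hX
  refine ⟨-β⁻¹, hr, eq_of_mgf_id_eqOn_Iio ((ae_map_iff hX measurableSet_Ici).2 h0)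
    (ae_nonneg_gammaMeasure 1 _) fun t (ht : t < 0) => ?_⟩
  calc mgf id (P.map X) t = (1 + β * t)⁻¹ := by rw [mgf_id_map hX, ← hα, ← h t ht, inv_inv]
    _ = -β⁻¹ / (-β⁻¹ - t) := by
      rw [← mul_div_mul_left _ _ (neg_ne_zero.2 hβ.ne), mul_sub, neg_mul_neg,
        mul_inv_cancel₀ hβ.ne, neg_mul, sub_neg_eq_add, one_div]
    _ = mgf id (expMeasure (-β⁻¹)) t := (mgf_id_expMeasure hr (ht.trans hr)).symm

end ExponentialDistribution

section FunctionalEquation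

lemma div_sub_mul_mixture_eq {K : Type*} [Field K] {r u v q : K} (hu : r - u ≠ 0)
    (hv : r - v ≠ 0) (huv : r - ((1 - q) * u + q * v) ≠ 0) :
    r / (r - ((1 - q) * u + q * v)) * (q * (r / (r - u)) + (1 - q) * (r / (r - v))) =
      r / (r - u) * (r / (r - v)) := by
  field_simp
  ring

lemma mul_mixedDeriv_eq_of_eq_mul {𝕜 : Type*} [NontriviallyNormedField 𝕜] {F : 𝕜 → 𝕜 → 𝕜}
    {f g F₁ : 𝕜 → 𝕜} {x y F₂ F₁₂ : 𝕜} {S T : Set 𝕜} (hS : S ∈ 𝓝 x) (hT : T ∈ 𝓝 y)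
    (h : ∀ s ∈ S, ∀ t ∈ T, F s t = f s * g t) (h₁ : ∀ t ∈ T, HasDerivAt (F · t) (F₁ t) x)
    (h₂ : HasDerivAt (F x) F₂ y) (h₁₂ : HasDerivAt F₁ F₁₂ y) : F x y * F₁₂ = F₁ y * F₂ := by
  have hx := mem_of_mem_nhds hS
  have hy := mem_of_mem_nhds hT
  have hrank (s) (hs : s ∈ S) (t) (ht : t ∈ T) : F x y * F s t = F s y * F x t := by
    rw [h x hx y hy, h s hs t ht, h s hs y hy, h x hx t ht]
    ring
  have hrank₁ (t) (ht : t ∈ T) : F x y * F₁ t = F₁ y * F x t :=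
    ((h₁ t ht).const_mul (F x y)).unique <| ((h₁ y hy).mul_const (F x t)).congr_of_eventuallyEq <|
      eventually_of_mem hS fun s hs => hrank s hs t ht
  exact (h₁₂.const_mul (F x y)).unique <| (h₂.const_mul (F₁ y)).congr_of_eventuallyEq <|
    eventually_of_mem hT hrank₁

variable {φ φ' φ'' : ℝ → ℝ} {S : Set ℝ}

lemma mul_secondDeriv_eq_of_mixture_eq_mul {p : ℝ} (hp : p ∈ Set.Ioo 0 1) (hS : IsOpen S)
    (hconv : Convex ℝ S) (hφ : ∀ x ∈ S, HasDerivAt φ (φ' x) x)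
    (hφ' : ∀ x ∈ S, HasDerivAt φ' (φ'' x) x) (hne : ∀ x ∈ S, φ x ≠ 0) {f g : ℝ → ℝ}
    (h : ∀ s ∈ S, ∀ t ∈ S,
      φ ((1 - p) * s + p * t) * (p * φ s + (1 - p) * φ t) = f s * g t)
    {x : ℝ} (hx : x ∈ S) : φ x * φ'' x = 2 * φ' x ^ 2 := by
  have hmem {s t : ℝ} (hs : s ∈ S) (ht : t ∈ S) : (1 - p) * s + p * t ∈ S :=
    hconv hs ht (sub_pos.2 hp.2).le hp.1.le (sub_add_cancel 1 p)
  have hdiag : (1 - p) * x + p * x = x := by ring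
  have hcomp {G G' : ℝ → ℝ} (hG : ∀ y ∈ S, HasDerivAt G (G' y) y) :
      HasDerivAt (fun t => G ((1 - p) * x + p * t)) (G' x * p) x := by
    have hinner : HasDerivAt (fun t => (1 - p) * x + p * t) p x := by
      simpa using ((hasDerivAt_id x).const_mul p).const_add ((1 - p) * x)
    exact HasDerivAt.comp x (by simpa only [hdiag] using hG x hx) hinner
  have h₁ (t : ℝ) (ht : t ∈ S) :
      HasDerivAt (fun s => φ ((1 - p) * s + p * t) * (p * φ s + (1 - p) * φ t))
        (φ' ((1 - p) * x + p * t) * (1 - p) * (p * φ x + (1 - p) * φ t) +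
          φ ((1 - p) * x + p * t) * (p * φ' x)) x := by
    have hinner : HasDerivAt (fun s => (1 - p) * s + p * t) (1 - p) x := by
      simpa using ((hasDerivAt_id x).const_mul (1 - p)).add_const (p * t)
    exact ((hφ _ (hmem hx ht)).comp x hinner).mul (((hφ x hx).const_mul p).add_const _)
  have hsum : HasDerivAt (fun t => p * φ x + (1 - p) * φ t) ((1 - p) * φ' x) x :=
    ((hφ x hx).const_mul (1 - p)).const_add (p * φ x)
  have hmixed := mul_mixedDeriv_eq_of_eq_mul (hS.mem_nhds hx) (hS.mem_nhds hx) h h₁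
    ((hcomp hφ).mul hsum)
    ((((hcomp hφ').mul_const (1 - p)).mul hsum).add ((hcomp hφ).mul_const (p * φ' x)))
  simp only [hdiag] at hmixed
  have hfactor : p * (1 - p) * φ x ^ 2 ≠ 0 :=
    mul_ne_zero (mul_ne_zero hp.1.ne' (sub_pos.2 hp.2).ne') (pow_ne_zero 2 (hne x hx))
  apply mul_left_cancel₀ hfactor
  linear_combination hmixed

lemma exists_eq_affine_of_secondDeriv_eq_zero {𝕜 : Type*} [RCLike 𝕜] {f f' : 𝕜 → 𝕜} {S : Set 𝕜}
    (hS : IsOpen S) (hconn : IsPreconnected S) (hf : ∀ x ∈ S, HasDerivAt f (f' x) x)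
    (hf' : ∀ x ∈ S, HasDerivAt f' 0 x) : ∃ α β : 𝕜, ∀ x ∈ S, f x = α + β * x := by
  obtain ⟨β, hβ⟩ := hS.exists_is_const_of_deriv_eq_zero hconn
    (fun x hx => (hf' x hx).differentiableAt.differentiableWithinAt) fun x hx => (hf' x hx).deriv
  have hlin (x : 𝕜) : HasDerivAt (fun y => β * y) β x := by
    simpa using (hasDerivAt_id x).const_mul β
  obtain ⟨α, hα⟩ := hS.exists_eq_add_of_deriv_eq hconn
    (fun x hx => (hf x hx).differentiableAt.differentiableWithinAt)
    (fun x _ => (hlin x).differentiableAt.differentiableWithinAt)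
    fun x hx => by rw [(hf x hx).deriv, hβ x hx, (hlin x).deriv]
  exact ⟨α, β, fun x hx => (hα hx).trans (add_comm _ _)⟩

lemma exists_inv_eq_affine_of_mul_secondDeriv_eq (hS : IsOpen S) (hconn : IsPreconnected S)
    (hφ : ∀ x ∈ S, HasDerivAt φ (φ' x) x) (hφ' : ∀ x ∈ S, HasDerivAt φ' (φ'' x) x)
    (hne : ∀ x ∈ S, φ x ≠ 0) (h : ∀ x ∈ S, φ x * φ'' x = 2 * φ' x ^ 2) :
    ∃ α β : ℝ, ∀ x ∈ S, (φ x)⁻¹ = α + β * x := by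
  refine exists_eq_affine_of_secondDeriv_eq_zero hS hconn (f' := fun x => -φ' x / φ x ^ 2)
    (fun x hx => (hφ x hx).fun_inv (hne x hx)) fun x hx => ?_
  refine ((hφ' x hx).fun_neg.fun_div ((hφ x hx).fun_pow 2)
    (pow_ne_zero 2 (hne x hx))).congr_deriv ?_
  rw [div_eq_zero_iff]
  left
  push_cast
  linear_combination -φ x * h x hx

end FunctionalEquation

section Independence

lemma indepFun_const_mul_iff {Ω G₀ : Type*} [MeasurableSpace Ω] {P : Measure Ω}
    [GroupWithZero G₀] [MeasurableSpace G₀] [MeasurableMul G₀] {U V : Ω → G₀} {a b : G₀}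
    (ha : a ≠ 0) (hb : b ≠ 0) :
    IndepFun (fun ω => a * U ω) (fun ω => b * V ω) P ↔ IndepFun U V P := by
  refine ⟨fun h => ?_, fun h => h.comp (measurable_const_mul a) (measurable_const_mul b)⟩
  simpa only [Function.comp_def, inv_mul_cancel_left₀ ha, inv_mul_cancel_left₀ hb] using
    h.comp (measurable_const_mul a⁻¹) (measurable_const_mul b⁻¹)

lemma indepFun_of_map_prodMk_eq_prod {Ω α β : Type*} [MeasurableSpace Ω] [MeasurableSpace α]
    [MeasurableSpace β] {P : Measure Ω} [IsFiniteMeasure P] {U : Ω → α} {V : Ω → β}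
    {μ : Measure α} {ν : Measure β} [IsProbabilityMeasure μ] [IsProbabilityMeasure ν]
    (hU : AEMeasurable U P) (hV : AEMeasurable V P)
    (h : P.map (fun ω => (U ω, V ω)) = μ.prod ν) : IndepFun U V P :=
  indepFun_of_identDistrib_pair (indepFun_prod measurable_id measurable_id)
    ⟨aemeasurable_id, hU.prodMk hV, Measure.map_id.trans h.symm⟩

lemma map_prodMk_eq_prod_of_integral_cexp_eq {Ω : Type*} [MeasurableSpace Ω] {P : Measure Ω}
    [IsFiniteMeasure P] {U V : Ω → ℝ} {μ ν : Measure ℝ} [IsFiniteMeasure μ] [IsFiniteMeasure ν]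
    (hU : AEMeasurable U P) (hV : AEMeasurable V P)
    (h : ∀ s t : ℝ, ∫ ω, Complex.exp (s * Complex.I * U ω + t * Complex.I * V ω) ∂P =
      charFun μ s * charFun ν t) :
    P.map (fun ω => (U ω, V ω)) = μ.prod ν := by
  refine charFun_eq_prod_iff.1 fun t => ?_
  rw [← h, charFun_apply, integral_map (by fun_prop) (by fun_prop),
    integral_map (by fun_prop) (by fun_prop)]
  congr with ω
  rw [WithLp.prod_inner_apply]
  push_cast [RCLike.inner_apply, conj_trivial]
  ring_nf

end Independence

section RandomCoefficients

variable {Ω : Type*} [MeasurableSpace Ω] {P : Measure Ω} [IsProbabilityMeasure P]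
  {X Y ε : Ω → ℝ}

lemma ae_eq_zero_or_one_of_measure_eq {p : ℝ} (hp : p ∈ Set.Icc 0 1) (hε : AEMeasurable ε P)
    (hε1 : P {ω | ε ω = 1} = ENNReal.ofReal p)
    (hε0 : P {ω | ε ω = 0} = ENNReal.ofReal (1 - p)) : ∀ᵐ ω ∂P, ε ω = 0 ∨ ε ω = 1 := by
  have h0 : NullMeasurableSet {ω | ε ω = 0} P :=
    hε.nullMeasurableSet_preimage (measurableSet_singleton 0)
  have h1 : NullMeasurableSet {ω | ε ω = 1} P :=
    hε.nullMeasurableSet_preimage (measurableSet_singleton 1)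
  have hdisj : Disjoint {ω | ε ω = 0} {ω | ε ω = 1} :=
    Set.disjoint_left.2 fun ω (hω0 : ε ω = 0) (hω1 : ε ω = 1) => zero_ne_one (hω0.symm.trans hω1)
  have hunion : P ({ω | ε ω = 0} ∪ {ω | ε ω = 1}) = 1 := by
    rw [measure_union₀ h1 hdisj.aedisjoint, hε0, hε1,
      ← ENNReal.ofReal_add (sub_nonneg.2 hp.2) hp.1, sub_add_cancel, ENNReal.ofReal_one]
  exact (prob_compl_eq_zero_iff₀ (h0.union h1)).2 hunion

lemma integral_cexp_bernoulli_mul (hY : AEMeasurable Y P) (hε : AEMeasurable ε P)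
    (hYε : IndepFun Y ε P) (h01 : ∀ᵐ ω ∂P, ε ω = 0 ∨ ε ω = 1) {u v : ℂ}
    (hu : u.re ∈ integrableExpSet Y P) (hv : v.re ∈ integrableExpSet Y P) :
    ∫ ω, Complex.exp ((ε ω * u + (1 - ε ω) * v) * Y ω) ∂P =
      (P[ε] : ℝ) * complexMGF Y P u + (1 - (P[ε] : ℝ)) * complexMGF Y P v := by
  have hεint : Integrable (fun ω => (ε ω : ℂ)) P := by
    refine Integrable.of_bound (by fun_prop) 1 ?_
    filter_upwards [h01] with ω hω
    rcases hω with hω | hω <;> simp [hω]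
  have hind (z : ℂ) : IndepFun (fun ω => (ε ω : ℂ)) (fun ω => Complex.exp (z * Y ω)) P :=
    hYε.symm.comp (φ := fun x : ℝ => (x : ℂ)) (ψ := fun y : ℝ => Complex.exp (z * y))
      (by fun_prop) (by fun_prop)
  have hind' (z : ℂ) : IndepFun (fun ω => 1 - (ε ω : ℂ)) (fun ω => Complex.exp (z * Y ω)) P :=
    (hind z).comp (φ := fun x => 1 - x) (ψ := id) (by fun_prop) measurable_id
  have hYu := integrable_cexp_mul_of_re_mem_integrableExpSet hY hu
  have hYv := integrable_cexp_mul_of_re_mem_integrableExpSet hY hv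
  calc ∫ ω, Complex.exp ((ε ω * u + (1 - ε ω) * v) * Y ω) ∂P
      = ∫ ω, ε ω * Complex.exp (u * Y ω) + (1 - ε ω) * Complex.exp (v * Y ω) ∂P := by
        refine integral_congr_ae ?_
        filter_upwards [h01] with ω hω
        rcases hω with hω | hω <;> simp [hω]
    _ = (∫ ω, (ε ω : ℂ) * Complex.exp (u * Y ω) ∂P) +
          ∫ ω, (1 - (ε ω : ℂ)) * Complex.exp (v * Y ω) ∂P :=
        integral_add ((hind u).integrable_mul hεint hYu)
          ((hind' v).integrable_mul ((integrable_const 1).sub hεint) hYv)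
    _ = _ := by
        rw [(hind u).integral_fun_mul_eq_mul_integral (by fun_prop) (by fun_prop),
          (hind' v).integral_fun_mul_eq_mul_integral (by fun_prop) (by fun_prop),
          integral_sub (integrable_const _) hεint, integral_complex_ofReal]
        simp [complexMGF]

lemma integral_cexp_randomCoeff_forms (hX : AEMeasurable X P) (hY : AEMeasurable Y P)
    (hε : AEMeasurable ε P) (hindep : iIndepFun ![X, Y, ε] P)
    (h01 : ∀ᵐ ω ∂P, ε ω = 0 ∨ ε ω = 1) (α β : ℝ) {u v : ℂ}
    (hu : u.re ∈ integrableExpSet Y P) (hv : v.re ∈ integrableExpSet Y P) :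
    ∫ ω, Complex.exp (u * (α * X ω + ε ω * Y ω : ℝ) + v * (β * X ω + (1 - ε ω) * Y ω : ℝ)) ∂P =
      complexMGF X P (α * u + β * v) *
        ((P[ε] : ℝ) * complexMGF Y P u + (1 - (P[ε] : ℝ)) * complexMGF Y P v) := by
  have hmeas : ∀ i, AEMeasurable (![X, Y, ε] i) P := by
    intro i
    fin_cases i <;> assumption
  have hYε : IndepFun Y ε P := hindep.indepFun (i := 1) (j := 2) (by decide)
  have hX_Yε : IndepFun X (fun ω => (Y ω, ε ω)) P :=
    (hindep.indepFun_prodMk₀ hmeas 1 2 0 (by decide) (by decide)).symm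
  calc _ = ∫ ω, Complex.exp ((α * u + β * v) * X ω) *
        Complex.exp ((ε ω * u + (1 - ε ω) * v) * Y ω) ∂P := by
        congr with ω
        rw [← Complex.exp_add]
        push_cast
        ring_nf
    _ = complexMGF X P (α * u + β * v) *
        ∫ ω, Complex.exp ((ε ω * u + (1 - ε ω) * v) * Y ω) ∂P :=
        hX_Yε.integral_fun_comp_mul_comp (f := fun x : ℝ => Complex.exp ((α * u + β * v) * x))
          (g := fun y : ℝ × ℝ => Complex.exp ((y.2 * u + (1 - y.2) * v) * y.1))
          hX (hY.prodMk hε) (by fun_prop) (by fun_prop)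
    _ = _ := by rw [integral_cexp_bernoulli_mul hY hε hYε h01 hu hv]

lemma mgf_mul_eq_of_indepFun_randomCoeff_forms (hX : AEMeasurable X P) (hY : AEMeasurable Y P)
    (hε : AEMeasurable ε P) (hindep : iIndepFun ![X, Y, ε] P)
    (h01 : ∀ᵐ ω ∂P, ε ω = 0 ∨ ε ω = 1) {α β : ℝ}
    (h : IndepFun (fun ω => α * X ω + ε ω * Y ω) (fun ω => β * X ω + (1 - ε ω) * Y ω) P)
    {s t : ℝ} (hs : s ∈ integrableExpSet Y P) (ht : t ∈ integrableExpSet Y P) :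
    mgf X P (α * s + β * t) * (P[ε] * mgf Y P s + (1 - P[ε]) * mgf Y P t) =
      mgf (fun ω => α * X ω + ε ω * Y ω) P s * mgf (fun ω => β * X ω + (1 - ε ω) * Y ω) P t := by
  have hjoint := integral_cexp_randomCoeff_forms hX hY hε hindep h01 α β (u := s) (v := t) hs ht
  simp only [Complex.exp_add] at hjoint
  have hprod := h.integral_fun_comp_mul_comp (f := fun x : ℝ => Complex.exp (s * x))
    (g := fun y : ℝ => Complex.exp (t * y)) (by fun_prop) (by fun_prop) (by fun_prop) (by fun_prop)
  have hcomplex := hjoint.symm.trans (hprod.trans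
    (congrArg₂ (· * ·) (complexMGF_ofReal s) (complexMGF_ofReal t)))
  rw [← Complex.ofReal_mul, ← Complex.ofReal_mul, ← Complex.ofReal_add] at hcomplex
  simp only [complexMGF_ofReal] at hcomplex
  exact_mod_cast hcomplex

theorem exists_map_eq_expMeasure_of_indepFun_randomCoeff_forms {p : ℝ} (hp : p ∈ Set.Ioo 0 1)
    (hε : AEMeasurable ε P) (h01 : ∀ᵐ ω ∂P, ε ω = 0 ∨ ε ω = 1) (hεp : P[ε] = p)
    (hXY : IdentDistrib X Y P P) (hindep : iIndepFun ![X, Y, ε] P)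
    (h0 : ∀ᵐ ω ∂P, 0 ≤ X ω) (hne : ¬ X =ᵐ[P] 0)
    (h : IndepFun (fun ω => (1 - p) * X ω + ε ω * Y ω)
      (fun ω => p * X ω + (1 - ε ω) * Y ω) P) :
    ∃ r, 0 < r ∧ P.map X = expMeasure r := by
  have hX := hXY.aemeasurable_fst
  have hY := hXY.aemeasurable_snd
  have hY0 : ∀ᵐ ω ∂P, 0 ≤ Y ω := hXY.ae_snd (p := fun x => 0 ≤ x) measurableSet_Ici h0
  have hdomX := Iio_subset_interior_integrableExpSet_of_nonneg hX h0
  have hdomY := Iic_subset_integrableExpSet_of_nonneg hY hY0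
  have hanalytic (t : ℝ) (ht : t ∈ Set.Iio 0) : AnalyticAt ℝ (mgf X P) t :=
    analyticAt_mgf (hdomX ht)
  have hderiv (t : ℝ) (ht : t ∈ Set.Iio 0) := (hanalytic t ht).differentiableAt.hasDerivAt
  have hderiv₂ (t : ℝ) (ht : t ∈ Set.Iio 0) := (hanalytic t ht).deriv.differentiableAt.hasDerivAt
  have hmgf_ne (t : ℝ) (ht : t ∈ Set.Iio 0) : mgf X P t ≠ 0 :=
    (mgf_pos (integrable_of_mem_integrableExpSet (interior_subset (hdomX ht)))).ne'
  have hfactor (s : ℝ) (hs : s ∈ Set.Iio 0) (t : ℝ) (ht : t ∈ Set.Iio 0) :=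
    mgf_mul_eq_of_indepFun_randomCoeff_forms hX hY hε hindep h01 h
      (hdomY (Set.Iio_subset_Iic_self hs)) (hdomY (Set.Iio_subset_Iic_self ht))
  simp only [hεp, ← mgf_congr_identDistrib hXY] at hfactor
  obtain ⟨α, β, haffine⟩ := exists_inv_eq_affine_of_mul_secondDeriv_eq isOpen_Iio
    isPreconnected_Iio hderiv hderiv₂ hmgf_ne fun t ht =>
      mul_secondDeriv_eq_of_mixture_eq_mul hp isOpen_Iio (convex_Iio 0) hderiv hderiv₂ hmgf_ne
        hfactor ht
  exact exists_map_eq_expMeasure_of_inv_mgf_affine hX h0 hne haffine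

theorem map_randomCoeff_forms_eq_prod_expMeasure (hX : AEMeasurable X P) (hY : AEMeasurable Y P)
    (hε : AEMeasurable ε P) (h01 : ∀ᵐ ω ∂P, ε ω = 0 ∨ ε ω = 1)
    (hindep : iIndepFun ![X, Y, ε] P) {r : ℝ} (hr : 0 < r) (hXr : P.map X = expMeasure r)
    (hYr : P.map Y = expMeasure r) :
    P.map (fun ω => ((1 - P[ε]) * X ω + ε ω * Y ω, P[ε] * X ω + (1 - ε ω) * Y ω)) =
      (expMeasure r).prod (expMeasure r) := by
  have := isProbabilityMeasure_expMeasure hr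
  refine map_prodMk_eq_prod_of_integral_cexp_eq (by fun_prop) (by fun_prop) fun s t => ?_
  have hdom (k : ℝ) : (k * Complex.I).re ∈ integrableExpSet Y P := by
    simp [integrableExpSet]
  have hcomb : ((1 - P[ε] : ℝ) : ℂ) * (s * Complex.I) + (P[ε] : ℝ) * (t * Complex.I) =
      (((1 - P[ε]) * s + P[ε] * t : ℝ) : ℂ) * Complex.I := by
    push_cast
    ring
  have hne (k : ℝ) : (r : ℂ) - k * Complex.I ≠ 0 := fun h0 =>
    hr.ne' (by simpa using congrArg Complex.re h0)
  have hne_comb := hne ((1 - P[ε]) * s + P[ε] * t)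
  rw [integral_cexp_randomCoeff_forms hX hY hε hindep h01 _ _ (hdom s) (hdom t), hcomb,
    complexMGF_mul_I hX, complexMGF_mul_I hY, complexMGF_mul_I hY, hXr, hYr]
  simp only [charFun_expMeasure hr]
  rw [← hcomb, Complex.ofReal_sub, Complex.ofReal_one] at hne_comb ⊢
  exact div_sub_mul_mixture_eq (hne s) (hne t) hne_comb

end RandomCoefficients

theorem theorem1_general {Ω : Type*} [MeasurableSpace Ω] (P : Measure Ω) [IsProbabilityMeasure P]
    (p : ℝ) (hp : p ∈ Set.Ioo (0 : ℝ) 1) (a b : ℝ) (ha : a ≠ 0) (hb : b ≠ 0)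
    (X Y ε : Ω → ℝ) (hε : AEMeasurable ε P)
    (hε1 : P {ω | ε ω = 1} = ENNReal.ofReal p)
    (hε0 : P {ω | ε ω = 0} = ENNReal.ofReal (1 - p))
    (hXY : IdentDistrib X Y P P)
    (hindep : iIndepFun ![X, Y, ε] P)
    (h0 : ∀ᵐ ω ∂P, 0 ≤ X ω) (hne : ¬ X =ᵐ[P] 0) :
    IndepFun (fun ω => (1 - p) * a * X ω + ε ω * a * Y ω)
        (fun ω => p * b * X ω + (1 - ε ω) * b * Y ω) P ↔
      ∃ r : ℝ, 0 < r ∧ P.map X = expMeasure r ∧ P.map Y = expMeasure r := by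
  have h01 := ae_eq_zero_or_one_of_measure_eq (Set.Ioo_subset_Icc_self hp) hε hε1 hε0
  have hεp : P[ε] = p := by
    rw [integral_of_ae_eq_zero_or_one hε h01, measureReal_def, hε1, ENNReal.toReal_ofReal hp.1.le]
  have hX := hXY.aemeasurable_fst
  have hY := hXY.aemeasurable_snd
  have hforms : IndepFun (fun ω => (1 - p) * a * X ω + ε ω * a * Y ω)
        (fun ω => p * b * X ω + (1 - ε ω) * b * Y ω) P ↔
      IndepFun (fun ω => (1 - p) * X ω + ε ω * Y ω) (fun ω => p * X ω + (1 - ε ω) * Y ω) P := by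
    rw [← indepFun_const_mul_iff (U := fun ω => (1 - p) * X ω + ε ω * Y ω)
      (V := fun ω => p * X ω + (1 - ε ω) * Y ω) ha hb]
    ring_nf
  rw [hforms, ← hXY.map_eq]
  simp only [and_self]
  constructor
  · exact exists_map_eq_expMeasure_of_indepFun_randomCoeff_forms hp hε h01 hεp hXY hindep h0 hne
  · rintro ⟨r, hr, hXr⟩
    have := isProbabilityMeasure_expMeasure hr
    exact indepFun_of_map_prodMk_eq_prod (by fun_prop) (by fun_prop)
      (hεp ▸ map_randomCoeff_forms_eq_prod_expMeasure hX hY hε h01 hindep hr hXr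
        (hXY.map_eq ▸ hXr))

theorem theorem1 {Ω : Type*} [MeasurableSpace Ω] (P : Measure Ω) [IsProbabilityMeasure P]
    (p : ℝ) (hp : p ∈ Set.Ioo (0 : ℝ) 1) (a b : ℝ) (ha : 0 < a) (hb : 0 < b)
    (X Y ε : Ω → ℝ) (hX : Measurable X) (hY : Measurable Y) (hε : Measurable ε)
    (hε1 : P {ω | ε ω = 1} = ENNReal.ofReal p)
    (hε0 : P {ω | ε ω = 0} = ENNReal.ofReal (1 - p))
    (hXY : IdentDistrib X Y P P)
    (hindep : iIndepFun ![X, Y, ε] P)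
    (hXpos : ∀ᵐ ω ∂P, 0 < X ω) (hYpos : ∀ᵐ ω ∂P, 0 < Y ω) :
    IndepFun (fun ω => (1 - p) * a * X ω + ε ω * a * Y ω)
        (fun ω => p * b * X ω + (1 - ε ω) * b * Y ω) P ↔
      ∃ r : ℝ, 0 < r ∧ P.map X = expMeasure r ∧ P.map Y = expMeasure r := by
  have hne : ¬ X =ᵐ[P] 0 := fun h =>
    let ⟨_, hpos, hzero⟩ := (hXpos.and h).exists
    hpos.ne' hzero
  exact theorem1_general P p hp a b ha.ne' hb.ne' X Y ε hε.aemeasurable hε1 hε0 hXY hindep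
    (hXpos.mono fun _ => le_of_lt) hne
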